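/- Fix a non-principal ultrafilter $\omega$ on $\mathbb{N}$, and let $\mathfrak{U}$ be a family of finite-dimensional unitary groups $U(k)$, each equipped with a norm $\|\cdot\|$ on $M_k(\mathbb{C})$ that is submultiplicative and bi-invariant under $U(k)$ (the same $U(k)$ may occur several times with different norms). For a group $\Gamma$ and maps $\phi, \psi : \Gamma \to U(k)$ put $$\operatorname{def}(\phi) := \sup_{g,h\in\Gamma} \|\phi(gh)-\phi(g)\phi(h)\|, \qquad \operatorname{dist}(\phi,\psi) := \sup_{g\in\Gamma}\|\phi(g)-\psi(g)\|.$$ A countable group $\Gamma$ is called uniformly $\mathfrak{U}$-stable with a linear estimate if for every sequence of maps $\phi_n : \Gamma \to U(k_n)$, with $(U(k_n), \|\cdot\|_n) \in \mathfrak{U}$ and $\operatorname{def}(\phi_n) \to 0$, there exist homomorphisms $\psi_n : \Gamma \to U(k_n)$ such that $\operatorname{dist}(\phi_n,\psi_n) = O_\omega(\operatorname{def}(\phi_n))$, that is, there is a constant $C$ (which may depend on the sequence) with $\operatorname{dist}(\phi_n,\psi_n) \le C \operatorname{def}(\phi_n)$ for $\omega$-almost all $n$. A subgroup $\Lambda \le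 \Gamma$ is called coamenable if there is a $\Gamma$-invariant mean on $\Gamma/\Lambda$, that is, a linear functional $m : \ell^\infty(\Gamma/\Lambda) \to \mathbb{R}$ with $m(1)=1$, $|m(f)| \le \|f\|_\infty$ and $m(g\cdot f)=m(f)$ for all $g\in\Gamma$ and $f \in \ell^\infty(\Gamma/\Lambda)$, where $(g\cdot f)(x) = f(g^{-1}x)$. Let $\Gamma$ be a countable group and let $\Lambda \le \Gamma$ be a coamenable subgroup. If $\Lambda$ is uniformly $\mathfrak{U}$-stable with a linear estimate, then so is $\Gamma$. -/

import Mathlib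

namespace UniformStability

open scoped ENNReal

/-- A finite-dimensional unitary group `U(k)` together with a norm on the complex vector space of
`k × k` complex matrices that is submultiplicative and bi-invariant under `U(k)`. -/
structure NormedUnitaryGroup where
  /-- the degree `k` -/
  deg : ℕ
  /-- the norm; `Seminorm` provides non-negativity, the triangle inequality and homogeneity -/
  nrm : Seminorm ℂ (Matrix (Fin deg) (Fin deg) ℂ)
  eq_zero_of_nrm_eq_zero : ∀ A, nrm A = 0 → A = 0
  nrm_mul_le : ∀ A B, nrm (A * B) ≤ nrm A * nrm B
  nrm_unitary_mul : ∀ U ∈ Matrix.unitaryGroup (Fin deg) ℂ, ∀ A, nrm (U * A) = nrm A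
  nrm_mul_unitary : ∀ U ∈ Matrix.unitaryGroup (Fin deg) ℂ, ∀ A, nrm (A * U) = nrm A

/-- The underlying group `U(k)`. -/
abbrev NormedUnitaryGroup.U (G : NormedUnitaryGroup) : Type :=
  ↥(Matrix.unitaryGroup (Fin G.deg) ℂ)

/-- The distance `‖u - v‖` between two elements of `U(k)`. -/
noncomputable def NormedUnitaryGroup.d (G : NormedUnitaryGroup) (u v : G.U) : ℝ :=
  G.nrm ((u : Matrix (Fin G.deg) (Fin G.deg) ℂ) - (v : Matrix (Fin G.deg) (Fin G.deg) ℂ))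

/-- Distances in `U(k)` are uniformly bounded, so the suprema below are suprema of non-empty
bounded sets of reals. -/
theorem NormedUnitaryGroup.d_le (G : NormedUnitaryGroup) (u v : G.U) :
    G.d u v ≤ 2 * G.nrm 1 := by
  have hu : G.nrm (u : Matrix (Fin G.deg) (Fin G.deg) ℂ) = G.nrm 1 := by
    simpa using G.nrm_unitary_mul u.1 u.2 1
  have hv : G.nrm (v : Matrix (Fin G.deg) (Fin G.deg) ℂ) = G.nrm 1 := by
    simpa using G.nrm_unitary_mul v.1 v.2 1
  have h := map_sub_le_add G.nrm (u : Matrix (Fin G.deg) (Fin G.deg) ℂ)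
    (v : Matrix (Fin G.deg) (Fin G.deg) ℂ)
  rw [hu, hv] at h
  unfold NormedUnitaryGroup.d
  linarith

/-- The defect `sup_{g, h} ‖φ(gh) - φ(g) φ(h)‖` of a map `φ : Γ → U(k)`. -/
noncomputable def defect {Γ : Type*} [Group Γ] (G : NormedUnitaryGroup) (φ : Γ → G.U) : ℝ :=
  ⨆ p : Γ × Γ, G.d (φ (p.1 * p.2)) (φ p.1 * φ p.2)

/-- The uniform distance `sup_g ‖φ(g) - ψ(g)‖` between two maps `φ, ψ : Γ → U(k)`. -/
noncomputable def uniformDist {Γ : Type*} (G : NormedUnitaryGroup) (φ ψ : Γ → G.U) : ℝ :=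
  ⨆ g : Γ, G.d (φ g) (ψ g)

/-- A uniform asymptotic homomorphism: a sequence of maps `φ n : Γ → U(k_n)` whose defects tend
to `0`. -/
def IsUniformAsymptoticHom {Γ : Type*} [Group Γ] (G : ℕ → NormedUnitaryGroup)
    (φ : ∀ n, Γ → (G n).U) : Prop :=
  Filter.Tendsto (fun n => defect (G n) (φ n)) Filter.atTop (nhds 0)

/-- `Γ` is uniformly `𝔘`-stable with a linear estimate: for every uniform asymptotic homomorphism
`φ : Γ → 𝔘` there is a sequence of homomorphisms `ψ` with the same range such that
`dist(φ, ψ) = O_ω(def(φ))`. -/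
def UniformlyStableWithLinearEstimate (ω : Ultrafilter ℕ) (𝔘 : Set NormedUnitaryGroup)
    (Γ : Type*) [Group Γ] : Prop :=
  ∀ G : ℕ → NormedUnitaryGroup, (∀ n, G n ∈ 𝔘) →
    ∀ φ : ∀ n, Γ → (G n).U, IsUniformAsymptoticHom G φ →
      ∃ ψ : ∀ n, Γ →* (G n).U,
        Asymptotics.IsBigO (ω : Filter ℕ) (fun n => uniformDist (G n) (φ n) (ψ n))
          (fun n => defect (G n) (φ n))

/-- The left translate `(g · f)(x) = f(g⁻¹ x)` of `f ∈ ℓ^∞(Γ / Λ)`. -/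
noncomputable def translate {Γ : Type*} [Group Γ] {Λ : Subgroup Γ} (g : Γ)
    (f : lp (fun _ : Γ ⧸ Λ => ℝ) ∞) : lp (fun _ : Γ ⧸ Λ => ℝ) ∞ :=
  ⟨fun x => f (g⁻¹ • x), by
    have hf := memℓp_infty_iff.1 (lp.memℓp f)
    refine memℓp_infty_iff.2 (hf.mono ?_)
    rintro _ ⟨x, rfl⟩
    exact ⟨g⁻¹ • x, rfl⟩⟩

/-- `Λ ≤ Γ` is coamenable: the coset space `Γ / Λ` admits a `Γ`-invariant mean. -/
def Coamenable {Γ : Type*} [Group Γ] (Λ : Subgroup Γ) : Prop :=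
  ∃ m : lp (fun _ : Γ ⧸ Λ => ℝ) ∞ →ₗ[ℝ] ℝ,
    m 1 = 1 ∧ (∀ f, |m f| ≤ ‖f‖) ∧ ∀ (g : Γ) f, m (translate g f) = m f

end UniformStability

/-! The proof is a Newton iteration. Let `φ` have defect ε. Its restriction to Λ lies within Cε of a
homomorphism. Correcting `φ` along Λ-cosets by that homomorphism gives an exact unitary cocycle f(g,
x) on Γ/Λ within O(ε) of `φ` (`exists_cocycle`). Let T(g) be its invariant mean over x. By
invariance, T(gh) - T(g)T(h) is the mean of (f(g, hx) - T(g))(f(h, x) - T(h)), so the first-order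
terms cancel and the error is O(ε²) (`exists_mean_cocycle`). Polar decomposition makes T unitary at
a further O(ε²) cost (`exists_unitary_near`).

Iterating, the corrections sum to O(ε), and compactness of U(k) yields a homomorphism. Each step
treats a new map, so constants independent of the map are needed;
`UniformlyStableWithLinearEstimate.exists_uniform` extracts them from the sequential hypothesis. -/

namespace UniformStability

open scoped ENNReal

/-! ### Means of vector-valued functions. -/

section Mean

variable {X V W : Type*} [AddCommGroup V] [Module ℝ V] [AddCommGroup W] [Module ℝ W]

/-- `v` is the weak mean of the vector-valued function `F` with respect to the functional `m` on
`ℓ^∞(X)`. -/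
def IsMean (m : lp (fun _ : X => ℝ) ∞ →ₗ[ℝ] ℝ) (F : X → V) (v : V) : Prop :=
  ∀ L : Module.Dual ℝ V, ∃ h : Memℓp (fun x => L (F x)) ∞, m ⟨fun x => L (F x), h⟩ = L v

variable {m : lp (fun _ : X => ℝ) ∞ →ₗ[ℝ] ℝ}

theorem exists_isMean [FiniteDimensional ℝ V] {F : X → V}
    (hF : ∀ L : Module.Dual ℝ V, Memℓp (fun x => L (F x)) ∞) : ∃ v, IsMean m F v := by
  let e : Module.Dual ℝ (Module.Dual ℝ V) :=
    { toFun := fun L => m ⟨fun x => L (F x), hF L⟩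
      map_add' := fun L L' => by
        rw [← map_add]
        rfl
      map_smul' := fun c L => by
        rw [RingHom.id_apply, ← map_smul]
        rfl }
  refine ⟨(Module.evalEquiv ℝ V).symm e, fun L => ⟨hF L, ?_⟩⟩
  rw [Module.apply_evalEquiv_symm_apply]
  rfl

theorem IsMean.unique {F : X → V} {v w : V} (hv : IsMean m F v) (hw : IsMean m F w) : v = w := by
  rw [← sub_eq_zero, ← Module.forall_dual_apply_eq_zero_iff ℝ]
  intro L
  obtain ⟨_, h1⟩ := hv L
  obtain ⟨_, h2⟩ := hw L
  rw [map_sub, ← h1, ← h2, sub_self]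

theorem IsMean.add {F F' : X → V} {v v' : V} (hv : IsMean m F v) (hv' : IsMean m F' v') :
    IsMean m (fun x => F x + F' x) (v + v') := by
  intro L
  obtain ⟨a, h1⟩ := hv L
  obtain ⟨b, h2⟩ := hv' L
  have e : (fun x => L (F x + F' x)) = (fun x => L (F x)) + fun x => L (F' x) := by
    ext x
    simp
  refine ⟨by rw [e]; exact a.add b, ?_⟩
  rw [map_add, ← h1, ← h2, ← map_add]
  congr 1
  exact Subtype.ext e

theorem IsMean.map {F : X → V} {v : V} (hv : IsMean m F v) (A : V →ₗ[ℝ] W) :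
    IsMean m (fun x => A (F x)) (A v) :=
  fun L => hv (L ∘ₗ A)

theorem IsMean.sub {F F' : X → V} {v v' : V} (hv : IsMean m F v) (hv' : IsMean m F' v') :
    IsMean m (fun x => F x - F' x) (v - v') := by
  simpa [sub_eq_add_neg] using hv.add (hv'.map (-LinearMap.id))

theorem isMean_const (h1 : m 1 = 1) (v : V) : IsMean m (fun _ => v) v := by
  intro L
  have e : (fun _ : X => L v) = (L v) • (1 : X → ℝ) := by
    ext x
    simp
  refine ⟨by rw [e]; exact (one_memℓp_infty).const_smul _, ?_⟩
  have : (⟨fun _ => L v, by rw [e]; exact (one_memℓp_infty).const_smul _⟩ :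
      lp (fun _ : X => ℝ) ∞) = (L v) • (1 : lp (fun _ : X => ℝ) ∞) := Subtype.ext e
  rw [this, map_smul, h1, smul_eq_mul, mul_one]

/-- Hahn–Banach supplies `L` dominated by `p` with `L v = p v`, which reduces the bound to the
scalar one for `m`. -/
theorem IsMean.seminorm_le (hm : ∀ f, |m f| ≤ ‖f‖) {F : X → V} {v : V} (hv : IsMean m F v)
    (p : Seminorm ℝ V) {c : ℝ} (hc : 0 ≤ c) (hF : ∀ x, p (F x) ≤ c) : p v ≤ c := by
  by_cases h0 : v = 0
  · simpa [h0] using hc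
  obtain ⟨L, hL, hLp⟩ := Module.Dual.exists_extension_of_le_seminorm_real (p := p)
    (Submodule.span ℝ {v})
    (p v • ((LinearEquiv.toSpanNonzeroSingleton ℝ V v h0).symm :
      Submodule.span ℝ {v} →ₗ[ℝ] ℝ)) (by
    intro x
    obtain ⟨t, rfl⟩ := (LinearEquiv.toSpanNonzeroSingleton ℝ V v h0).surjective x
    rw [LinearMap.smul_apply, LinearEquiv.coe_coe, LinearEquiv.symm_apply_apply,
      LinearEquiv.toSpanNonzeroSingleton_apply, map_smul_eq_mul, smul_eq_mul, Real.norm_eq_abs,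
      mul_comm]
    exact mul_le_mul_of_nonneg_right (le_abs_self t) (apply_nonneg p v))
  have hLv : L v = p v := by
    have := hL ((LinearEquiv.toSpanNonzeroSingleton ℝ V v h0) 1)
    rw [LinearMap.smul_apply, LinearEquiv.coe_coe, LinearEquiv.symm_apply_apply,
      LinearEquiv.toSpanNonzeroSingleton_apply] at this
    simpa using this
  obtain ⟨h, e⟩ := hv L
  rw [← hLv, ← e]
  exact (le_abs_self _).trans ((hm _).trans
    (lp.norm_le_of_forall_le hc fun x => (hLp (F x)).trans (hF x)))

end Mean

theorem IsMean.translate {Γ V : Type*} [Group Γ] [AddCommGroup V] [Module ℝ V] {Λ : Subgroup Γ}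
    {m : lp (fun _ : Γ ⧸ Λ => ℝ) ∞ →ₗ[ℝ] ℝ} (hm : ∀ (g : Γ) f, m (translate g f) = m f)
    {F : Γ ⧸ Λ → V} {v : V} (hv : IsMean m F v) (g : Γ) : IsMean m (fun x => F (g • x)) v := by
  intro L
  obtain ⟨h, e⟩ := hv L
  have key : (fun x => L (F (g • x))) =
      UniformStability.translate g⁻¹ (⟨fun x => L (F x), h⟩ : lp (fun _ : Γ ⧸ Λ => ℝ) ∞) := by
    ext x
    simp [UniformStability.translate]
  refine ⟨by rw [key]; exact lp.memℓp _, ?_⟩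
  rw [← e, ← hm g⁻¹ ⟨fun x => L (F x), h⟩]
  congr 1
  exact Subtype.ext key

end UniformStability
-- Polar decomposition in a bi-invariant norm.
namespace UniformStability

namespace NormedUnitaryGroup

open Matrix
open scoped ComplexOrder

variable (G : NormedUnitaryGroup)

local notation "Mat" => Matrix (Fin G.deg) (Fin G.deg) ℂ

/-- A real diagonal contraction is the average of a diagonal unitary, with entries e + i√(1 - e²),
and its adjoint. -/
theorem nrm_diagonal_mul_le (A : Mat) (e : Fin G.deg → ℝ) (he : ∀ i, |e i| ≤ 1) :
    G.nrm (A * diagonal fun i => (e i : ℂ)) ≤ G.nrm A := by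
  set w : Fin G.deg → ℂ := fun i => e i + Real.sqrt (1 - e i ^ 2) * Complex.I with hw
  have hww : ∀ i, star (w i) * w i = 1 := by
    intro i
    have h1 : 0 ≤ 1 - e i ^ 2 := by
      have := (sq_le_one_iff_abs_le_one (e i)).2 (he i)
      linarith
    have h2 := Real.sq_sqrt h1
    apply Complex.ext
    · simp [hw]
      nlinarith
    · simp [hw]
      ring
  have hW : diagonal w ∈ unitaryGroup (Fin G.deg) ℂ := by
    rw [mem_unitaryGroup_iff', star_eq_conjTranspose, diagonal_conjTranspose, diagonal_mul_diagonal]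
    simp only [Pi.star_apply, hww, diagonal_one]
  have hW' := Unitary.star_mem hW
  have hsum : (diagonal fun i => (e i : ℂ)) =
      ((1 / 2 : ℝ) : ℂ) • diagonal w + ((1 / 2 : ℝ) : ℂ) • star (diagonal w) := by
    rw [star_eq_conjTranspose, diagonal_conjTranspose, ← diagonal_smul, ← diagonal_smul,
      diagonal_add]
    congr 1
    ext i
    simp [hw]
    ring
  rw [hsum, mul_add, mul_smul_comm, mul_smul_comm]
  refine (map_add_le_add _ _ _).trans ?_
  rw [map_smul_eq_mul, map_smul_eq_mul, G.nrm_mul_unitary _ hW, G.nrm_mul_unitary _ hW',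
    Complex.norm_real]
  norm_num
  linarith

/-- The matrix `P` with all columns `v` satisfies AP = P, so submultiplicativity forces it to
vanish. -/
theorem eq_zero_of_mulVec_eq_self {A : Mat} (hA : G.nrm A < 1) {v : Fin G.deg → ℂ}
    (hv : A *ᵥ v = v) : v = 0 := by
  set P : Mat := of fun i _ => v i with hP
  have hAP : A * P = P := by
    ext i j
    exact congrFun hv i
  have h1 := G.nrm_mul_le A P
  rw [hAP] at h1
  have h0 : P = 0 := G.eq_zero_of_nrm_eq_zero P (by
    nlinarith [apply_nonneg G.nrm P])
  ext i
  exact congrFun (congrFun h0 i) i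

/-- The unitary part of the polar decomposition of `T` is as close to `T` as `T* T` is to `1`. -/
theorem exists_unitary_near (T : Mat) (hT : G.nrm (star T * T - 1) < 1) :
    ∃ U : G.U, G.nrm (T - U) ≤ G.nrm (star T * T - 1) := by
  have hH : (star T * T).IsHermitian := isHermitian_conjTranspose_mul_self T
  obtain ⟨Q, l, hQ⟩ : ∃ (Q : G.U) (l : Fin G.deg → ℝ),
      star T * T = (Q : Mat) * diagonal (fun i => (l i : ℂ)) * star (Q : Mat) := by
    refine ⟨hH.eigenvectorUnitary, hH.eigenvalues, ?_⟩
    conv_lhs => rw [hH.spectral_theorem]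
    rfl
  have hQ1 : (Q : Mat) * star (Q : Mat) = 1 := mem_unitaryGroup_iff.1 Q.2
  have hQ2 : star (Q : Mat) * (Q : Mat) = 1 := mem_unitaryGroup_iff'.1 Q.2
  have hD : star (T * (Q : Mat)) * (T * (Q : Mat)) = diagonal fun i => (l i : ℂ) := by
    calc _ = star (Q : Mat) * (star T * T) * (Q : Mat) := by simp only [star_mul, mul_assoc]
      _ = (star (Q : Mat) * Q) * diagonal (fun i => (l i : ℂ)) * (star (Q : Mat) * Q) := by
        rw [hQ]; simp only [mul_assoc]
      _ = _ := by rw [hQ2, one_mul, mul_one]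
  have hl : ∀ i, 0 < l i := by
    intro i
    have h0 : 0 ≤ l i := by
      have h := (posSemidef_conjTranspose_mul_self (T * (Q : Mat))).diag_nonneg (i := i)
      rw [← star_eq_conjTranspose, hD, diagonal_apply_eq] at h
      exact_mod_cast h
    -- A zero eigenvalue would give a nonzero vector fixed by 1 - T*T, whose norm is less than 1.
    refine lt_of_le_of_ne h0 fun hz => ?_
    have hk : (1 - star T * T) *ᵥ ((Q : Mat) *ᵥ Pi.single i 1) = (Q : Mat) *ᵥ Pi.single i 1 := by
      rw [sub_mulVec, one_mulVec, hQ, mulVec_mulVec, mul_assoc, hQ2, mul_one, ← mulVec_mulVec,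
        diagonal_mulVec_single, ← hz]
      simp
    have hv := G.eq_zero_of_mulVec_eq_self (by rwa [← map_sub_rev] at hT) hk
    have hs : star (Q : Mat) *ᵥ ((Q : Mat) *ᵥ Pi.single i 1) = Pi.single i (1 : ℂ) := by
      rw [mulVec_mulVec, hQ2, one_mulVec]
    rw [hv, mulVec_zero] at hs
    simpa using congrFun hs i
  set s : Fin G.deg → ℝ := fun i => Real.sqrt (l i) with hs
  have hs0 : ∀ i, 0 < s i := fun i => Real.sqrt_pos.2 (hl i)
  have hss : ∀ i, s i * s i = l i := fun i => Real.mul_self_sqrt (hl i).le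
  set S : Mat := diagonal fun i => (s i : ℂ) with hS
  set R : Mat := diagonal fun i => (((s i)⁻¹ : ℝ) : ℂ) with hR
  have hRS : R * S = 1 := by
    rw [hR, hS, diagonal_mul_diagonal, ← diagonal_one]
    congr 1
    ext i
    rw [← Complex.ofReal_mul, inv_mul_cancel₀ (hs0 i).ne', Complex.ofReal_one]
  have hRstar : star R = R := by
    rw [hR, star_eq_conjTranspose, diagonal_conjTranspose]
    congr 1
    ext i
    simp
  have hV : T * (Q : Mat) * R ∈ unitaryGroup (Fin G.deg) ℂ := by
    rw [mem_unitaryGroup_iff', star_mul, hRstar]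
    calc R * star (T * (Q : Mat)) * (T * Q * R) = R * (star (T * (Q : Mat)) * (T * Q)) * R := by
          simp only [mul_assoc]
      _ = 1 := by
        rw [hD, hR, diagonal_mul_diagonal, diagonal_mul_diagonal, ← diagonal_one]
        congr 1
        ext i
        rw [← Complex.ofReal_mul, ← Complex.ofReal_mul, ← hss i, ← Complex.ofReal_one]
        congr 1
        have := (hs0 i).ne'
        field_simp
  set V : G.U := ⟨T * (Q : Mat) * R, hV⟩ with hVdef
  -- This is T(T*T)^(-1/2).
  refine ⟨V * star Q, ?_⟩
  have hTQ : T * (Q : Mat) = (V : Mat) * S := by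
    rw [hVdef]
    simp only [mul_assoc, hRS, mul_one]
  have h1 : G.nrm (T - ((V * star Q : G.U) : Mat)) = G.nrm (S - 1) := by
    rw [← G.nrm_mul_unitary _ Q.2, sub_mul, hTQ, ← G.nrm_unitary_mul _ V.2 (S - 1), mul_sub]
    congr 2
    rw [mul_one]
    change (V : Mat) * star (Q : Mat) * Q = V
    rw [mul_assoc, hQ2, mul_one]
  have h2 : G.nrm (star T * T - 1) = G.nrm ((diagonal fun i => (l i : ℂ)) - 1) := by
    rw [← hD, ← G.nrm_mul_unitary _ Q.2, ← G.nrm_unitary_mul _ (star Q).2]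
    congr 1
    change star (Q : Mat) * ((star T * T - 1) * Q) = _
    rw [sub_mul, mul_sub, one_mul, hQ2, star_mul]
    simp only [mul_assoc]
  rw [h1, h2]
  -- S - 1 = (S² - 1)(S + 1)⁻¹, and the last factor is a diagonal contraction.
  have h3 : S - 1 = ((diagonal fun i => (l i : ℂ)) - 1) *
      diagonal fun i => (((s i + 1)⁻¹ : ℝ) : ℂ) := by
    rw [hS, ← diagonal_one, diagonal_sub, diagonal_sub, diagonal_mul_diagonal]
    congr 1
    ext i
    rw [← hss i, ← Complex.ofReal_one, ← Complex.ofReal_sub, ← Complex.ofReal_sub,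
      ← Complex.ofReal_mul]
    congr 1
    have : s i + 1 ≠ 0 := by linarith [hs0 i]
    field_simp
    ring
  rw [h3]
  refine G.nrm_diagonal_mul_le _ _ fun i => ?_
  have := hs0 i
  rw [abs_of_pos (by positivity)]
  exact inv_le_one_of_one_le₀ (by linarith)

end NormedUnitaryGroup

end UniformStability
-- Compactness, the metric on U(k), and uniform constants.
namespace UniformStability

open scoped ENNReal
open Filter Topology

theorem isCompact_unitaryGroup (n : Type*) [Fintype n] [DecidableEq n] :
    IsCompact (Matrix.unitaryGroup n ℂ : Set (Matrix n n ℂ)) := by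
  have hK : IsCompact (Set.pi Set.univ fun _ : n => Set.pi Set.univ fun _ : n =>
      Metric.closedBall (0 : ℂ) 1) :=
    isCompact_univ_pi fun _ => isCompact_univ_pi fun _ => isCompact_closedBall _ _
  refine IsCompact.of_isClosed_subset hK (isClosed_unitary (R := Matrix n n ℂ)) fun U hU => ?_
  exact fun i _ j _ => mem_closedBall_zero_iff.2 <| entry_norm_bound_of_unitary hU i j

namespace NormedUnitaryGroup

variable (G : NormedUnitaryGroup)

local notation "Mat" => Matrix (Fin G.deg) (Fin G.deg) ℂ

theorem nrm_le_sum (A : Mat) : G.nrm A ≤ ∑ i, ∑ j, ‖A i j‖ * G.nrm (Matrix.single i j 1) := by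
  conv_lhs => rw [Matrix.matrix_eq_sum_single A]
  refine
    (Finset.le_sum_of_subadditive G.nrm (map_zero _).le (map_add_le_add _) _ _).trans (Finset.sum_le_sum fun i _ => ?_)
  refine
    (Finset.le_sum_of_subadditive G.nrm (map_zero _).le (map_add_le_add _) _ _).trans (Finset.sum_le_sum fun j _ => ?_)
  rw [← map_smul_eq_mul, Matrix.smul_single, smul_eq_mul, mul_one]

theorem continuous_nrm : Continuous G.nrm := by
  rw [continuous_iff_continuousAt]
  intro A
  have h : Tendsto (fun B : Mat => ∑ i, ∑ j, ‖(B - A) i j‖ * G.nrm (Matrix.single i j 1)) (𝓝 A)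
      (𝓝 0) := by
    have hc : Continuous fun B : Mat =>
        ∑ i, ∑ j, ‖(B - A) i j‖ * G.nrm (Matrix.single i j 1) := by
      refine continuous_finsetSum _ fun i _ => continuous_finsetSum _ fun j _ => ?_
      exact (((continuous_id.sub continuous_const).matrix_elem i j).norm).mul continuous_const
    simpa using hc.tendsto A
  refine tendsto_iff_norm_sub_tendsto_zero.2 (squeeze_zero (fun _ => norm_nonneg _) (fun B => ?_) h)
  refine le_trans ?_ (G.nrm_le_sum (B - A))
  exact abs_sub_map_le_sub G.nrm B A

theorem d_triangle (u v w : G.U) : G.d u w ≤ G.d u v + G.d v w := by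
  unfold d
  refine le_trans (le_of_eq ?_) (map_add_le_add G.nrm _ _)
  rw [sub_add_sub_cancel]

theorem d_comm (u v : G.U) : G.d u v = G.d v u := map_sub_rev _ _ _

theorem d_nonneg (u v : G.U) : 0 ≤ G.d u v := apply_nonneg _ _

theorem d_mul_left (w u v : G.U) : G.d (w * u) (w * v) = G.d u v := by
  unfold d
  rw [← G.nrm_unitary_mul w.1 w.2 (u - v), mul_sub]
  rfl

theorem d_mul_right (u v w : G.U) : G.d (u * w) (v * w) = G.d u v := by
  unfold d
  rw [← G.nrm_mul_unitary w.1 w.2 (u - v), sub_mul]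
  rfl

theorem eq_of_d_eq_zero {u v : G.U} (h : G.d u v = 0) : u = v :=
  Subtype.ext (sub_eq_zero.1 (G.eq_zero_of_nrm_eq_zero _ h))

end NormedUnitaryGroup

section Bounds

variable {Γ : Type*} (G : NormedUnitaryGroup)

theorem defect_le_iff [Group Γ] {φ : Γ → G.U} {ε : ℝ} :
    defect G φ ≤ ε ↔ ∀ g h, G.d (φ (g * h)) (φ g * φ h) ≤ ε := by
  constructor
  · intro H g h
    refine le_trans ?_ H
    exact le_ciSup (f := fun p : Γ × Γ => G.d (φ (p.1 * p.2)) (φ p.1 * φ p.2))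
      ⟨2 * G.nrm 1, by rintro _ ⟨p, rfl⟩; exact G.d_le _ _⟩ (g, h)
  · exact fun H => ciSup_le fun p => H p.1 p.2

theorem uniformDist_le_iff [Nonempty Γ] {φ ψ : Γ → G.U} {ε : ℝ} :
    uniformDist G φ ψ ≤ ε ↔ ∀ g, G.d (φ g) (ψ g) ≤ ε := by
  constructor
  · intro H g
    exact (le_ciSup (f := fun g => G.d (φ g) (ψ g))
      ⟨2 * G.nrm 1, by rintro _ ⟨p, rfl⟩; exact G.d_le _ _⟩ g).trans H
  · exact fun H => ciSup_le H

theorem defect_nonneg [Group Γ] (φ : Γ → G.U) : 0 ≤ defect G φ :=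
  Real.iSup_nonneg fun _ => G.d_nonneg _ _

theorem uniformDist_nonneg (φ ψ : Γ → G.U) : 0 ≤ uniformDist G φ ψ :=
  Real.iSup_nonneg fun _ => G.d_nonneg _ _

end Bounds

/-- For a non-principal ultrafilter, the constant in the linear estimate can be chosen uniformly
over all maps of small defect. -/
theorem UniformlyStableWithLinearEstimate.exists_uniform {ω : Ultrafilter ℕ}
    (hω : (ω : Filter ℕ) ≤ cofinite) {𝔘 : Set NormedUnitaryGroup} {Λ : Type*} [Group Λ]
    (h : UniformlyStableWithLinearEstimate ω 𝔘 Λ) :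
    ∃ δ > 0, ∃ C ≥ 0, ∀ G ∈ 𝔘, ∀ φ : Λ → G.U, defect G φ < δ →
      ∃ ψ : Λ →* G.U, uniformDist G φ ψ ≤ C * defect G φ := by
  by_contra! H
  -- Counterexamples for δ = 1/(n+1) and C = n form one asymptotic homomorphism; its linear constant
  -- is exceeded by `n` for ω-almost all `n`.
  choose G hG φ hφ hψ using fun n : ℕ => H (1 / ((n : ℝ) + 1)) (by positivity) n (by positivity)
  obtain ⟨ψ, hO⟩ := h G hG φ (squeeze_zero (fun n => defect_nonneg _ _) (fun n => (hφ n).le)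
    tendsto_one_div_add_atTop_nhds_zero_nat)
  obtain ⟨c, hc⟩ := hO.bound
  have hlarge : ∀ᶠ n : ℕ in (ω : Filter ℕ), c ≤ n :=
    (Nat.cofinite_eq_atTop ▸ hω) (tendsto_natCast_atTop_atTop.eventually_ge_atTop c)
  obtain ⟨n, hn, hcn⟩ := (hc.and hlarge).exists
  have h1 := hψ n (ψ n)
  have h0 := defect_nonneg (G n) (φ n)
  rw [Real.norm_of_nonneg (uniformDist_nonneg _ _ _), Real.norm_of_nonneg h0] at hn
  exact absurd hn (not_le.2 (lt_of_le_of_lt (mul_le_mul_of_nonneg_right hcn h0) h1))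

/-! ### The Newton step. -/

section Step

variable {Γ : Type*} [Group Γ] {Λ : Subgroup Γ} {G : NormedUnitaryGroup}

/-- A map close to a homomorphism on `Λ` gives rise to an exact cocycle on `Γ ⧸ Λ` close to it. -/
theorem exists_cocycle {φ : Γ → G.U} {ψ : Λ →* G.U} {ε a : ℝ}
    (hφ : ∀ g h, G.d (φ (g * h)) (φ g * φ h) ≤ ε) (hψ : ∀ l : Λ, G.d (φ l) (ψ l) ≤ a) :
    ∃ f : Γ → Γ ⧸ Λ → G.U, (∀ g h x, f (g * h) x = f g (h • x) * f h x) ∧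
      ∀ g x, G.d (f g x) (φ g) ≤ 2 * a + 3 * ε := by
  let s : Γ ⧸ Λ → Γ := Quotient.out
  have hs : ∀ x : Γ ⧸ Λ, (s x : Γ ⧸ Λ) = x := fun x => Quotient.out_eq' x
  have hmem : ∀ g : Γ, (s g)⁻¹ * g ∈ Λ := fun g => QuotientGroup.eq.1 (hs g)
  -- Keep `φ` on the transversal and extend by `ψ` along each coset; the result is exactly right
  -- Λ-equivariant, so φ'(ga)φ'(a)⁻¹ depends only on the coset of a.
  let φ' : Γ → G.U := fun g => φ (s g) * ψ ⟨(s g)⁻¹ * g, hmem g⟩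
  have hright : ∀ (g : Γ) (l : Λ), φ' (g * l) = φ' g * ψ l := by
    intro g l
    have e : ((g * l : Γ) : Γ ⧸ Λ) = g := QuotientGroup.mk_mul_of_mem g l.2
    simp only [φ']
    rw [mul_assoc, ← map_mul]
    congr 2
    · rw [e]
    · apply Subtype.ext
      simp [e, mul_assoc]
  have hclose : ∀ g, G.d (φ' g) (φ g) ≤ a + ε := by
    intro g
    have h1 := hψ ⟨(s g)⁻¹ * g, hmem g⟩
    have h2 := hφ (s g) ((s g)⁻¹ * g)
    rw [mul_inv_cancel_left] at h2
    refine (G.d_triangle _ (φ (s g) * φ ((s g)⁻¹ * g)) _).trans (add_le_add ?_ ?_)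
    · rw [G.d_mul_left, G.d_comm]
      exact h1
    · rwa [G.d_comm]
  have hquot : ∀ g a b : Γ, (a : Γ ⧸ Λ) = b → φ' (g * a) * (φ' a)⁻¹ = φ' (g * b) * (φ' b)⁻¹ := by
    intro g a b hab
    obtain ⟨l, rfl⟩ : ∃ l : Λ, a * l = b := ⟨⟨a⁻¹ * b, QuotientGroup.eq.1 hab⟩, by simp⟩
    rw [← mul_assoc, hright, hright]
    group
  refine ⟨fun g x => φ' (g * s x) * (φ' (s x))⁻¹, fun g h x => ?_, fun g x => ?_⟩
  · have e : (s (h • x) : Γ ⧸ Λ) = (h * s x : Γ) := by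
      rw [hs]
      conv_lhs => rw [← hs x]
      rfl
    simp only
    rw [hquot g _ _ e, mul_assoc g]
    group
  · rw [← G.d_mul_right _ _ (φ' (s x)), inv_mul_cancel_right]
    -- Two replacements of `φ'` by `φ` cost a + ε each, and the defect of `φ` costs ε.
    have h1 := G.d_triangle (φ' (g * s x)) (φ (g * s x)) (φ g * φ' (s x))
    have h2 := G.d_triangle (φ (g * s x)) (φ g * φ (s x)) (φ g * φ' (s x))
    rw [G.d_mul_left, G.d_comm (φ (s x))] at h2
    linarith [hclose (g * s x), hclose (s x), hφ g (s x)]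

/-- The mean of an exact cocycle close to `φ` is multiplicative up to a quadratic error. -/
theorem exists_mean_cocycle {m : lp (fun _ : Γ ⧸ Λ => ℝ) ∞ →ₗ[ℝ] ℝ} (m_one : m 1 = 1)
    (m_le : ∀ f, |m f| ≤ ‖f‖) (m_translate : ∀ (g : Γ) f, m (translate g f) = m f)
    {φ : Γ → G.U} {f : Γ → Γ ⧸ Λ → G.U} {η : ℝ}
    (hf : ∀ g h x, f (g * h) x = f g (h • x) * f h x) (hη : ∀ g x, G.d (f g x) (φ g) ≤ η) :
    ∃ T : Γ → Matrix (Fin G.deg) (Fin G.deg) ℂ, T 1 = 1 ∧ (∀ g, T g⁻¹ = star (T g)) ∧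
      (∀ g, G.nrm (T g - φ g) ≤ η) ∧ ∀ g h, G.nrm (T (g * h) - T g * T h) ≤ 4 * η ^ 2 := by
  have η_nonneg : 0 ≤ η := (G.d_nonneg _ _).trans (hη 1 ((1 : Γ) : Γ ⧸ Λ))
  have hone : ∀ x, f 1 x = 1 := by
    intro x
    have := hf 1 1 x
    rw [one_smul, mul_one] at this
    exact left_eq_mul.1 this
  have hinv : ∀ g x, f g⁻¹ x = star (f g (g⁻¹ • x)) := by
    intro g x
    have := hf g g⁻¹ x
    rw [mul_inv_cancel, hone] at this
    exact eq_inv_of_mul_eq_one_right this.symm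
  have hmean : ∀ g, ∃ t, IsMean m (fun x => (f g x : Matrix (Fin G.deg) (Fin G.deg) ℂ)) t := by
    refine fun g => exists_isMean fun L => ?_
    rw [memℓp_infty_iff]
    refine (((isCompact_unitaryGroup (Fin G.deg)).image
      (LinearMap.continuous_of_finiteDimensional L).norm).bddAbove).mono ?_
    rintro _ ⟨x, rfl⟩
    exact ⟨_, (f g x).2, rfl⟩
  choose T hT using hmean
  have hle : ∀ {F : Γ ⧸ Λ → Matrix (Fin G.deg) (Fin G.deg) ℂ} {v c}, IsMean m F v → 0 ≤ c →
      (∀ x, G.nrm (F x) ≤ c) → G.nrm v ≤ c := fun hv hc hF =>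
    hv.seminorm_le m_le (G.nrm.restrictScalars ℝ) hc hF
  have hTφ : ∀ g, G.nrm (T g - φ g) ≤ η := fun g =>
    hle ((hT g).sub (isMean_const m_one _)) η_nonneg (hη g)
  refine ⟨T, ?_, fun g => ?_, hTφ, fun g h => ?_⟩
  · refine (hT 1).unique ?_
    simp only [hone]
    exact isMean_const m_one _
  · refine (hT g⁻¹).unique ?_
    simp only [hinv]
    exact ((hT g).translate m_translate g⁻¹).map
      ({ toFun := star
         map_add' := star_add
         map_smul' := fun c A => by simp } :
        Matrix (Fin G.deg) (Fin G.deg) ℂ →ₗ[ℝ] Matrix (Fin G.deg) (Fin G.deg) ℂ)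
  · have h1 := (hT g).translate m_translate h
    have h2 := ((((hT (g * h)).sub (h1.map (LinearMap.mulRight ℝ (T h)))).sub
      ((hT h).map (LinearMap.mulLeft ℝ (T g)))).add (isMean_const m_one (T g * T h)))
    simp only [LinearMap.mulRight_apply, LinearMap.mulLeft_apply, sub_add_cancel] at h2
    refine hle h2 (by positivity) fun x => ?_
    have e : ((f (g * h) x : Matrix (Fin G.deg) (Fin G.deg) ℂ) - f g (h • x) * T h - T g * f h x
        + T g * T h) = (f g (h • x) - T g) * (f h x - T h) := by
      rw [hf]
      simp only [Submonoid.coe_mul]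
      noncomm_ring
    have hb : ∀ g x, G.nrm (f g x - T g) ≤ 2 * η := by
      intro g x
      have := map_sub_le_add G.nrm ((f g x : Matrix (Fin G.deg) (Fin G.deg) ℂ) - φ g) (T g - φ g)
      rw [sub_sub_sub_cancel_right] at this
      have h3 : G.nrm ((f g x : Matrix (Fin G.deg) (Fin G.deg) ℂ) - φ g) ≤ η := hη g x
      linarith [hTφ g]
    rw [e]
    calc _ ≤ _ := G.nrm_mul_le _ _
      _ ≤ (2 * η) * (2 * η) := mul_le_mul (hb _ _) (hb _ _) (apply_nonneg _ _) (by positivity)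
      _ = _ := by ring

/-- A Newton step: a map close to a homomorphism on a coamenable subgroup can be replaced by a
nearby one of quadratically smaller defect. -/
theorem exists_improvement (hΛ : Coamenable Λ) {φ : Γ → G.U} {ψ : Λ →* G.U} {ε a η : ℝ}
    (hφ : ∀ g h, G.d (φ (g * h)) (φ g * φ h) ≤ ε) (hψ : ∀ l : Λ, G.d (φ l) (ψ l) ≤ a)
    (hη : 2 * a + 3 * ε ≤ η) (hη' : η ≤ 1 / 4) :
    ∃ φ' : Γ → G.U, (∀ g h, G.d (φ' (g * h)) (φ' g * φ' h) ≤ 20 * η ^ 2) ∧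
      ∀ g, G.d (φ g) (φ' g) ≤ 3 * η := by
  obtain ⟨m, m_one, m_le, m_translate⟩ := hΛ
  obtain ⟨f, hf, hfφ⟩ := exists_cocycle hφ hψ
  obtain ⟨T, T_one, T_inv, hTφ, hT⟩ :=
    exists_mean_cocycle m_one m_le m_translate hf fun g x => (hfφ g x).trans hη
  have η_nonneg : 0 ≤ η := (apply_nonneg _ _).trans (hTφ 1)
  have hη2 : 4 * η ^ 2 ≤ η := by nlinarith
  -- T(g)*T(g) = T(g⁻¹)T(g) and T(1) = 1, so the failure of unitarity is itself a multiplicativity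
  -- error.
  have hTT : ∀ g, G.nrm (star (T g) * T g - 1) ≤ 4 * η ^ 2 := by
    intro g
    rw [← T_inv, map_sub_rev, ← T_one, ← inv_mul_cancel g]
    exact hT _ _
  choose U hU using fun g => G.exists_unitary_near (T g) (by linarith [hTT g])
  have hTU : ∀ g, G.nrm (T g - U g) ≤ 4 * η ^ 2 := fun g => (hU g).trans (hTT g)
  refine ⟨U, fun g h => ?_, fun g => ?_⟩
  -- Five terms, each at most 4η², give 20η².
  · have e : ((U (g * h) : Matrix (Fin G.deg) (Fin G.deg) ℂ) - (U g * U h : G.U)) =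
        (T (g * h) - T g * T h) + ((T g - U g) * (T h - U h) + (U g * (T h - U h)
          + (T g - U g) * U h)) - (T (g * h) - U (g * h)) := by
      simp only [Submonoid.coe_mul]
      noncomm_ring
    have h1 : G.nrm ((T g - U g) * (T h - U h)) ≤ 4 * η ^ 2 := by
      refine (G.nrm_mul_le _ _).trans ?_
      calc _ ≤ (4 * η ^ 2) * 1 := mul_le_mul (hTU g) ((hTU h).trans (by linarith))
              (apply_nonneg _ _) (by positivity)
        _ = _ := mul_one _
    have h2 : G.nrm (U g * (T h - U h)) ≤ 4 * η ^ 2 := by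
      rw [G.nrm_unitary_mul _ (U g).2]
      exact hTU h
    have h3 : G.nrm ((T g - U g) * U h) ≤ 4 * η ^ 2 := by
      rw [G.nrm_mul_unitary _ (U h).2]
      exact hTU g
    unfold NormedUnitaryGroup.d
    rw [e]
    refine (map_sub_le_add _ _ _).trans ?_
    have h4 := map_add_le_add G.nrm (T (g * h) - T g * T h) ((T g - U g) * (T h - U h)
      + (U g * (T h - U h) + (T g - U g) * U h))
    have h5 := map_add_le_add G.nrm ((T g - U g) * (T h - U h))
      (U g * (T h - U h) + (T g - U g) * U h)
    have h6 := map_add_le_add G.nrm (U g * (T h - U h)) ((T g - U g) * U h)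
    linarith [hT g h, hTU (g * h)]
  · unfold NormedUnitaryGroup.d
    have h1 := map_sub_le_add G.nrm (T g - U g) (T g - φ g)
    rw [sub_sub_sub_cancel_left] at h1
    linarith [hTU g, hTφ g]

end Step

/-! ### Limit and iteration. -/

section Limit

variable {Γ : Type*} [Group Γ] {G : NormedUnitaryGroup}

/-- Maps whose defects tend to zero and which stay close to `φ` accumulate at a homomorphism. -/
theorem exists_hom_of_tendsto {φ : Γ → G.U} {u : ℕ → Γ → G.U} {ε : ℕ → ℝ} {c : ℝ}
    (hε : Tendsto ε atTop (𝓝 0))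
    (hu : ∀ n g h, G.d (u n (g * h)) (u n g * u n h) ≤ ε n) (hφ : ∀ n g, G.d (φ g) (u n g) ≤ c) :
    ∃ ψ : Γ →* G.U, ∀ g, G.d (φ g) (ψ g) ≤ c := by
  let l : Ultrafilter ℕ := hyperfilter ℕ
  have hl : (l : Filter ℕ) ≤ atTop := Nat.hyperfilter_le_atTop
  have hlim : ∀ g, ∃ v : G.U,
      Tendsto (fun n => (u n g : Matrix (Fin G.deg) (Fin G.deg) ℂ)) l (𝓝 v) := by
    intro g
    obtain ⟨v, hv, hle⟩ := (isCompact_unitaryGroup (Fin G.deg)).ultrafilter_le_nhds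
      (l.map fun n => (u n g : Matrix (Fin G.deg) (Fin G.deg) ℂ))
      (tendsto_principal.2 (Eventually.of_forall fun n => (u n g).2))
    exact ⟨⟨v, hv⟩, hle⟩
  choose v hv using hlim
  refine ⟨MonoidHom.mk' v fun g h => G.eq_of_d_eq_zero (le_antisymm ?_ (G.d_nonneg _ _)),
    fun g => ?_⟩
  · exact le_of_tendsto_of_tendsto' ((G.continuous_nrm.tendsto _).comp
      ((hv (g * h)).sub ((hv g).mul (hv h)))) (hε.mono_left hl) fun n => hu n g h
  · exact le_of_tendsto' ((G.continuous_nrm.tendsto _).comp (tendsto_const_nhds.sub (hv g)))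
      fun n => hφ n g

end Limit

/-- Uniform linear stability passes from a coamenable subgroup to the whole group. -/
theorem Coamenable.exists_uniform {𝔘 : Set NormedUnitaryGroup} {Γ : Type*} [Group Γ]
    {Λ : Subgroup Γ} (hΛ : Coamenable Λ) {δ C : ℝ} (hδ : 0 < δ) (hC : 0 ≤ C)
    (H : ∀ G ∈ 𝔘, ∀ φ : Λ → G.U, defect G φ < δ →
      ∃ ψ : Λ →* G.U, uniformDist G φ ψ ≤ C * defect G φ) :
    ∃ δ' > 0, ∃ C', ∀ G ∈ 𝔘, ∀ φ : Γ → G.U, defect G φ < δ' →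
      ∃ ψ : Γ →* G.U, uniformDist G φ ψ ≤ C' * defect G φ := by
  set K : ℝ := 2 * C + 3 with hK
  have hK0 : 3 ≤ K := by linarith
  -- With η = Kε2⁻ⁿ, the bound 40K²ε ≤ 1 makes 20η² at most half the current defect bound;
  -- displacements 3Kε2⁻ⁿ sum to 6Kε.
  refine ⟨min δ (1 / (40 * K ^ 2)), by positivity, 6 * K, fun G hG φ hφ => ?_⟩
  set ε := defect G φ with hε
  have ε_nonneg : 0 ≤ ε := defect_nonneg _ _
  have hεδ : ε < δ := hφ.trans_le (min_le_left _ _)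
  have hεK : 40 * K ^ 2 * ε ≤ 1 := by
    have := (hφ.trans_le (min_le_right _ _)).le
    rw [le_div_iff₀ (by positivity)] at this
    linarith
  have iter : ∀ n : ℕ, ∃ u : Γ → G.U, (∀ g h, G.d (u (g * h)) (u g * u h) ≤ ε * (1 / 2) ^ n) ∧
      ∀ g, G.d (φ g) (u g) ≤ 6 * K * ε * (1 - (1 / 2) ^ n) := by
    intro n
    induction n with
    | zero =>
      refine ⟨φ, ?_, fun g => ?_⟩
      · rw [pow_zero, mul_one]
        exact (defect_le_iff G).1 le_rfl
      · simp [NormedUnitaryGroup.d]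
    | succ n ih =>
      obtain ⟨u, hu, hφu⟩ := ih
      set t : ℝ := (1 / 2) ^ n with ht
      have t0 : 0 ≤ t := by positivity
      have t1 : t ≤ 1 := pow_le_one₀ (by norm_num) (by norm_num)
      have hεt : ε * t ≤ ε := mul_le_of_le_one_right ε_nonneg t1
      have hres : defect G (fun x : Λ => u x) ≤ ε * t :=
        (defect_le_iff G).2 fun g h => hu g h
      obtain ⟨ψ, hψ⟩ := H G hG (fun x : Λ => u x) (by linarith)
      have hψ' := (uniformDist_le_iff G).1 (hψ.trans (mul_le_mul_of_nonneg_left hres hC))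
      have hKε : K * (ε * t) ≤ 1 / 4 := by
        nlinarith
      obtain ⟨u', hu', huu'⟩ := exists_improvement hΛ hu hψ' (η := K * (ε * t))
        (le_of_eq (by rw [hK]; ring)) hKε
      refine ⟨u', fun g h => (hu' g h).trans ?_, fun g => ?_⟩
      · rw [pow_succ (1 / 2 : ℝ) n, ← ht]
        have h1 : 40 * K ^ 2 * (ε * t) ≤ 1 :=
          (mul_le_mul_of_nonneg_left hεt (by positivity)).trans hεK
        have h2 := mul_le_mul_of_nonneg_right h1 (mul_nonneg ε_nonneg t0)
        linarith
      · rw [pow_succ, ← ht]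
        have := G.d_triangle (φ g) (u g) (u' g)
        linarith [hφu g, huu' g]
  choose u hu hφu using iter
  obtain ⟨ψ, hψ⟩ := exists_hom_of_tendsto (ε := fun n => ε * (1 / 2) ^ n) (c := 6 * K * ε)
    (by simpa using (tendsto_pow_atTop_nhds_zero_of_lt_one (r := (1 / 2 : ℝ)) (by norm_num)
      (by norm_num)).const_mul ε) hu fun n g => (hφu n g).trans (mul_le_of_le_one_right
        (by positivity) (by linarith [pow_nonneg (by norm_num : (0 : ℝ) ≤ 1 / 2) n]))
  exact ⟨ψ, (uniformDist_le_iff G).2 hψ⟩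

end UniformStability

theorem proposition1p3 (ω : Ultrafilter ℕ) (hω : (ω : Filter ℕ) ≤ Filter.cofinite)
    (𝔘 : Set UniformStability.NormedUnitaryGroup)
    {Γ : Type*} [Group Γ] [Countable Γ] (Λ : Subgroup Γ)
    (hΛ : UniformStability.Coamenable Λ)
    (hstable : UniformStability.UniformlyStableWithLinearEstimate ω 𝔘 Λ) :
    UniformStability.UniformlyStableWithLinearEstimate ω 𝔘 Γ := by
  obtain ⟨δ, hδ, C, hC, H⟩ := hstable.exists_uniform hω
  obtain ⟨δ', hδ', C', H'⟩ := hΛ.exists_uniform hδ hC H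
  intro G hG φ hφ
  have hψ : ∀ n, ∃ ψ : Γ →* (G n).U, UniformStability.defect (G n) (φ n) < δ' →
      UniformStability.uniformDist (G n) (φ n) ψ ≤ C' * UniformStability.defect (G n) (φ n) := by
    intro n
    by_cases h : UniformStability.defect (G n) (φ n) < δ'
    · obtain ⟨ψ, hψ⟩ := H' (G n) (hG n) (φ n) h
      exact ⟨ψ, fun _ => hψ⟩
    -- Any homomorphism serves here: only finitely many `n` have large defect.
    · exact ⟨1, fun h' => absurd h' h⟩
  choose ψ hψ using hψ
  refine ⟨ψ, Asymptotics.IsBigO.of_bound C' ?_⟩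
  have hsmall := (Nat.cofinite_eq_atTop ▸ hω) (hφ.eventually_lt_const hδ')
  filter_upwards [hsmall] with n hn
  rw [Real.norm_of_nonneg (UniformStability.uniformDist_nonneg _ _ _),
    Real.norm_of_nonneg (UniformStability.defect_nonneg _ _)]
  exact hψ n hn
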